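/- For $\alpha\in[0,1]$ let $\mathbb I_\alpha=[\alpha-1,\alpha]$ and let Nakada's $\alpha$-continued fraction map $T_\alpha:\mathbb I_\alpha\to[\alpha-1,\alpha)$ be given by $T_\alpha(0)=0$ and $T_\alpha(x)=\left|\tfrac1x\right|-d_\alpha(x)$ for $x\ne0$, where $d_\alpha(x)=\left\lfloor\left|\tfrac1x\right|+1-\alpha\right\rfloor$; put $d_\alpha(0)=\infty$, and $\varepsilon(x)=+1$ if $x\ge0$, $\varepsilon(x)=-1$ if $x<0$. The cylinders of $T_\alpha$ are the nonempty sets among $\Delta_\alpha(\varepsilon,d)=\{x\in\mathbb I_\alpha : \varepsilon(x)=\varepsilon,\ d_\alpha(x)=d\}$; a cylinder $\Delta$ is full if $T_\alpha(\Delta)=[\alpha-1,\alpha)$, and non-full otherwise. The map $T_\alpha$ has bounded non-full range if there is a full cylinder whose interior is avoided by the $T_\alpha$-orbits of the endpoints of all non-full cylinders. A matching interval is an interval $J\subseteq[0,1]$, open in $[0,1]$, for which there are positive integers $k,k'$ with $T_\alpha^{k}(\alpha)=T_\alpha^{k'}(\alpha-1)$ for all $\alpha\in J$. The exceptional set $\mathcal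 E$ is the complement in $[0,1]$ of the union of all matching intervals. Then $T_\alpha$ has bounded non-full range for every rational $\alpha\in(0,1]$ and for every $\alpha\in\mathcal E$. -/

import Mathlib

open Set

noncomputable section

/-- Nakada's `α`-continued fraction map `T_α`, used on `[α - 1, α]`, with values in `[α - 1, α)`. -/
def nakadaMap (α x : ℝ) : ℝ :=
  if x = 0 then 0 else |1 / x| - (⌊|1 / x| + 1 - α⌋ : ℤ)

/-- The sign digit `ε(x)`. -/
def nakadaSign (x : ℝ) : ℤ := if 0 ≤ x then 1 else -1

/-- The digit `d_α(x)`, with `d_α(0) = ∞`. -/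
def nakadaDigit (α x : ℝ) : WithTop ℤ :=
  if x = 0 then ⊤ else ((⌊|1 / x| + 1 - α⌋ : ℤ) : WithTop ℤ)

/-- The cylinder `Δ_α(ε, d)`: the points of `[α - 1, α]` with first digit `(ε, d)`. -/
def nakadaCylinder (α : ℝ) (ε : ℤ) (d : WithTop ℤ) : Set ℝ :=
  {x | x ∈ Icc (α - 1) α ∧ nakadaSign x = ε ∧ nakadaDigit α x = d}

/-- The partition of `[α - 1, α]` into the (rank one, nonempty) cylinders of `T_α`. It includes the
exceptional one-point cylinder `{0}`. -/
def nakadaCylinders (α : ℝ) : Set (Set ℝ) :=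
  {K | K.Nonempty ∧ ∃ ε d, K = nakadaCylinder α ε d}

/-- A cylinder `K` of an interval map `T` with interval of values `I` is full if `T(K) = I`. -/
def IsFullCylinder (T : ℝ → ℝ) (I K : Set ℝ) : Prop := T '' K = I

/-- `e` is an endpoint of the bounded interval `K` (it need not belong to `K`). -/
def IsIntervalEndpoint (K : Set ℝ) (e : ℝ) : Prop := IsGLB K e ∨ IsLUB K e

/-- Bounded non-full range of an interval map `T`, with interval of values `I` and with set of
cylinders `𝒦`: there is a full cylinder whose interior is avoided by the orbits of the endpoints
of all non-full cylinders. -/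
def HasBoundedNonFullRange (T : ℝ → ℝ) (I : Set ℝ) (𝒦 : Set (Set ℝ)) : Prop :=
  ∃ K ∈ 𝒦, IsFullCylinder T I K ∧
    ∀ L ∈ 𝒦, ¬ IsFullCylinder T I L →
      ∀ e, IsIntervalEndpoint L e → ∀ n : ℕ, T^[n] e ∉ interior K

/-- `T_α` has bounded non-full range. As `T_α` maps `[α - 1, α]` to `[α - 1, α)`, full cylinders
are those with image `[α - 1, α)`. -/
def NakadaHasBoundedNonFullRange (α : ℝ) : Prop :=
  HasBoundedNonFullRange (nakadaMap α) (Ico (α - 1) α) (nakadaCylinders α)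

/-- A matching interval: an interval of parameters, open in `[0, 1]`, on which
`T_α^k(α) = T_α^{k'}(α - 1)` for one pair of positive integers `(k, k')`. -/
def IsNakadaMatchingInterval (J : Set ℝ) : Prop :=
  J.OrdConnected ∧ (∃ U : Set ℝ, IsOpen U ∧ J = U ∩ Icc 0 1) ∧
    ∃ k k' : ℕ, 0 < k ∧ 0 < k' ∧
      ∀ α ∈ J, (nakadaMap α)^[k] α = (nakadaMap α)^[k'] (α - 1)

/-- The exceptional set: the complement in `[0, 1]` of the union of all matching intervals. -/
def nakadaExceptionalSet : Set ℝ :=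
  Icc 0 1 \ ⋃₀ {J | IsNakadaMatchingInterval J}

end

open Filter Topology

/-! ### Basic properties of the map -/

/-! A nonzero cylinder endpoint other than `α` and `α - 1` has `|1 / e|` congruent to `α` mod 1: it
lies in no cylinder interior, and its image is `α - 1`. Cylinders with large digits are full and
shrink to 0, so it suffices that the orbits of `α` and `α - 1` avoid a punctured neighbourhood of 0
(`hasBoundedNonFullRange_of_orbits`). For rational `α` denominators never exceed the initial one,
which gives this at once.

For `α` in the exceptional set, `T_α` sees a nonzero `x` only through `|1 / x|` mod 1. Two points
`x`, `y` of the orbits of `α` and `α - 1` are tracked by one number `s`, with `|1 / x| ≡ s` and `|1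
/ y| ≡ 1 / s`, starting from `s = 1 / α - 1`. While `s` or `1 / s` is at least `1 + α`, moving one
of the points updates `s` by `slowMap`. If both drop below `1 + α`, the orbits merge two steps
later, and this persists for nearby parameters, so `α` lies in a matching interval
(`slow_orbit_avoids_zone`). Otherwise every later orbit point is at most `-(α / (1 + α))`
(`orbit_of_slow_orbit`). This needs `α` at most the golden mean `(√5 - 1) / 2`; above it matching is
immediate. -/

theorem nakadaMap_zero (α : ℝ) : nakadaMap α 0 = 0 := by simp [nakadaMap]

theorem nakadaMap_iterate_zero (α : ℝ) (n : ℕ) : (nakadaMap α)^[n] 0 = 0 :=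
  Function.iterate_fixed (nakadaMap_zero α) n

theorem nakadaMap_mem_Ico {α x : ℝ} (hx : x ≠ 0) : nakadaMap α x ∈ Ico (α - 1) α := by
  rw [nakadaMap, if_neg hx]
  have h1 := Int.floor_le (|1 / x| + 1 - α)
  have h2 := Int.lt_floor_add_one (|1 / x| + 1 - α)
  constructor <;> linarith

theorem nakadaMap_mem_Icc {α x : ℝ} (h0 : 0 ≤ α) (h1 : α ≤ 1) :
    nakadaMap α x ∈ Icc (α - 1) α := by
  by_cases hx : x = 0
  · rw [hx, nakadaMap_zero]
    constructor <;> linarith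
  · exact Ico_subset_Icc_self (nakadaMap_mem_Ico hx)

/-- `x` is nonzero and `|1 / x|` is congruent to `s` modulo `1`. -/
def InvCongr (x s : ℝ) : Prop := x ≠ 0 ∧ ∃ m : ℤ, |1 / x| = s + m

theorem InvCongr.nakadaMap_eq {α x s : ℝ} (h : InvCongr x s) (h1 : α ≤ s) (h2 : s < 1 + α) :
    nakadaMap α x = s - 1 := by
  obtain ⟨hx, m, hm⟩ := h
  have hf : ⌊|1 / x| + 1 - α⌋ = m + 1 := by
    rw [Int.floor_eq_iff, hm]
    push_cast
    constructor <;> linarith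
  rw [nakadaMap, if_neg hx, hf, hm]
  push_cast
  ring

theorem InvCongr.sub_one {x s : ℝ} (h : InvCongr x s) : InvCongr x (s - 1) := by
  obtain ⟨hx, m, hm⟩ := h
  refine ⟨hx, m + 1, ?_⟩
  rw [hm]
  push_cast
  ring

theorem InvCongr.map_eq_map {α x y s : ℝ} (hx : InvCongr x s) (hy : InvCongr y s) :
    nakadaMap α x = nakadaMap α y := by
  obtain ⟨hx, m, hm⟩ := hx
  obtain ⟨hy, n, hn⟩ := hy
  rw [nakadaMap, if_neg hx, nakadaMap, if_neg hy, hm, hn,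
    show s + m + 1 - α = s + 1 - α + m by ring, show s + n + 1 - α = s + 1 - α + n by ring,
    Int.floor_add_intCast, Int.floor_add_intCast]
  push_cast
  ring

/-! ### Cylinders -/

/-- Here `|1 / x| + 1 - α` is an integer, so pushing `x` slightly away from 0 lowers the digit. -/
theorem invCongr_not_mem_interior_cylinder {α x : ℝ} {ε : ℤ} {d : WithTop ℤ}
    (hx : InvCongr x α) : x ∉ interior (nakadaCylinder α ε d) := by
  intro hi
  obtain ⟨h0, m, hm⟩ := hx
  have hc : Tendsto (fun t : ℝ => t * x) (𝓝[>] 1) (𝓝 x) := by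
    have : Tendsto (fun t : ℝ => t * x) (𝓝 1) (𝓝 (1 * x)) :=
      (continuous_id.mul continuous_const).tendsto 1
    rw [one_mul] at this
    exact this.mono_left nhdsWithin_le_nhds
  have hev := hc.eventually (mem_interior_iff_mem_nhds.mp hi)
  obtain ⟨t, ht, ht1⟩ := (hev.and self_mem_nhdsWithin).exists
  have ht1 : 1 < t := ht1
  have htx : t * x ≠ 0 := mul_ne_zero (by linarith) h0
  have hd : nakadaDigit α (t * x) = nakadaDigit α x :=
    ht.2.2.trans (interior_subset hi).2.2.symm
  rw [nakadaDigit, nakadaDigit, if_neg htx, if_neg h0, WithTop.coe_eq_coe, hm,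
    show α + m + 1 - α = ((m + 1 : ℤ) : ℝ) by push_cast; ring, Int.floor_intCast] at hd
  have hle := Int.floor_le (|1 / (t * x)| + 1 - α)
  rw [hd] at hle
  have hlt : |1 / (t * x)| < |1 / x| := by
    rw [abs_div, abs_div, abs_mul, abs_of_pos (by linarith : (0 : ℝ) < t)]
    have : 0 < |x| := abs_pos.mpr h0
    apply div_lt_div_of_pos_left (by simp) this
    nlinarith
  push_cast at hle
  linarith

theorem nakadaSign_eventuallyEq {e : ℝ} (he : e ≠ 0) :
    ∀ᶠ x in 𝓝 e, nakadaSign x = nakadaSign e := by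
  rcases lt_or_gt_of_ne he with h | h
  · filter_upwards [Iio_mem_nhds h] with x hx
    rw [nakadaSign, nakadaSign, if_neg (not_le.mpr hx), if_neg (not_le.mpr h)]
  · filter_upwards [Ioi_mem_nhds h] with x hx
    rw [nakadaSign, nakadaSign, if_pos (le_of_lt hx), if_pos h.le]

theorem nakadaDigit_eventuallyEq {α e : ℝ} (he : e ≠ 0) (hα : ¬ InvCongr e α) :
    ∀ᶠ x in 𝓝 e, nakadaDigit α x = nakadaDigit α e := by
  have hc : ContinuousAt (fun x : ℝ => |1 / x| + 1 - α) e := by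
    have : ContinuousAt (fun x : ℝ => 1 / x) e := continuousAt_const.div continuousAt_id he
    exact (this.abs.add continuousAt_const).sub continuousAt_const
  set m := ⌊|1 / e| + 1 - α⌋ with hm
  have hle : (m : ℝ) ≤ |1 / e| + 1 - α := Int.floor_le _
  have hlt : (m : ℝ) < |1 / e| + 1 - α := by
    refine lt_of_le_of_ne hle fun h => hα ⟨he, m - 1, ?_⟩
    push_cast
    linarith
  filter_upwards [hc.eventually_const_lt hlt,
    hc.eventually_lt_const (Int.lt_floor_add_one (|1 / e| + 1 - α)),
    isOpen_ne.mem_nhds he] with x h1 h2 h3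
  rw [nakadaDigit, nakadaDigit, if_neg h3, if_neg he, WithTop.coe_eq_coe, ← hm, Int.floor_eq_iff]
  exact ⟨h1.le, h2⟩

theorem IsIntervalEndpoint.mem_closure {K : Set ℝ} {e : ℝ} (hK : K.Nonempty)
    (he : IsIntervalEndpoint K e) : e ∈ closure K :=
  he.elim (fun h => h.mem_closure hK) fun h => h.mem_closure hK

theorem IsIntervalEndpoint.not_mem_nhds {K : Set ℝ} {e : ℝ}
    (he : IsIntervalEndpoint K e) : K ∉ 𝓝 e := by
  intro h
  rcases he with he | he
  · obtain ⟨x, hx, hxe⟩ := ((eventually_nhdsWithin_of_eventually_nhds (s := Iio e) h).and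
      self_mem_nhdsWithin).exists
    exact absurd (he.1 hx) (not_le.mpr hxe)
  · obtain ⟨x, hx, hxe⟩ := ((eventually_nhdsWithin_of_eventually_nhds (s := Ioi e) h).and
      self_mem_nhdsWithin).exists
    exact absurd (he.1 hx) (not_le.mpr hxe)

/-- The endpoints of the cylinders. -/
theorem endpoint_of_cylinder {α e : ℝ} {ε : ℤ} {d : WithTop ℤ}
    (hne : (nakadaCylinder α ε d).Nonempty) (he : IsIntervalEndpoint (nakadaCylinder α ε d) e) :
    e = 0 ∨ e = α ∨ e = α - 1 ∨ InvCongr e α := by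
  by_contra! hcon
  obtain ⟨h0, h1, h2, h3⟩ := hcon
  have hcl := he.mem_closure hne
  have hI : e ∈ Icc (α - 1) α :=
    closure_minimal (fun x hx => hx.1) isClosed_Icc hcl
  have hI' : Ioo (α - 1) α ∈ 𝓝 e :=
    Ioo_mem_nhds (lt_of_le_of_ne hI.1 h2.symm) (lt_of_le_of_ne hI.2 h1)
  have hs := nakadaSign_eventuallyEq h0
  have hd := nakadaDigit_eventuallyEq h0 h3
  obtain ⟨y, hy, hyK⟩ := mem_closure_iff_nhds.mp hcl _ (hs.and hd)
  apply he.not_mem_nhds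
  filter_upwards [hI', hs, hd] with x hx hxs hxd
  exact ⟨Ioo_subset_Icc_self hx, by rw [hxs, ← hy.1, hyK.2.1], by rw [hxd, ← hy.2, hyK.2.2]⟩

/-- A cylinder with a large digit is full, provided it is on a side on which `0` is not an endpoint
of the domain. -/
theorem isFullCylinder_of_large {α c : ℝ} {σ : ℝ} {ε d : ℤ} (hα : α ∈ Icc (0 : ℝ) 1) (hc : 0 < c)
    (hd : 1 / c < d - 1)
    (hσ : σ = 1 ∧ ε = 1 ∧ c ≤ α ∨ σ = -1 ∧ ε = -1 ∧ c ≤ 1 - α) :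
    IsFullCylinder (nakadaMap α) (Ico (α - 1) α) (nakadaCylinder α ε d) := by
  obtain ⟨ha0, ha1⟩ := hα
  have hcd : 0 < 1 / c := by positivity
  apply Subset.antisymm
  · rintro _ ⟨x, hx, rfl⟩
    apply nakadaMap_mem_Ico
    rintro rfl
    have := hx.2.2
    simp [nakadaDigit] at this
  · intro y hy
    have hpos : 1 / c < d + y := by linarith [hy.1]
    have hpos0 : 0 < d + y := by linarith
    have hlt : 1 / (d + y) < c := by
      rw [div_lt_iff₀ hpos0]
      rw [div_lt_iff₀ hc] at hpos
      linarith
    have hpos1 : 0 < 1 / (d + y) := by positivity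
    have habs : |σ| = 1 := by rcases hσ with h | h <;> simp [h.1]
    have hne : σ / (d + y) ≠ 0 := by
      have : σ ≠ 0 := by rcases hσ with h | h <;> simp [h.1]
      positivity
    have hinv : |1 / (σ / (d + y))| = d + y := by
      rw [one_div_div, abs_div, habs, div_one, abs_of_pos hpos0]
    have hfl : ⌊|1 / (σ / (d + y))| + 1 - α⌋ = d := by
      rw [hinv, Int.floor_eq_iff]
      constructor <;> linarith [hy.1, hy.2]
    refine ⟨σ / (d + y), ⟨?_, ?_, ?_⟩, ?_⟩
    · rcases hσ with ⟨rfl, -, h⟩ | ⟨rfl, -, h⟩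
      · constructor <;> linarith
      · rw [neg_div]
        constructor <;> linarith
    · rcases hσ with ⟨rfl, rfl, h⟩ | ⟨rfl, rfl, h⟩
      · rw [nakadaSign, if_pos hpos1.le]
      · rw [nakadaSign, neg_div, if_neg (by linarith)]
    · rw [nakadaDigit, if_neg hne, hfl]
    · rw [nakadaMap, if_neg hne, hfl, hinv]
      ring

theorem abs_lt_of_mem_cylinder {α c x : ℝ} {ε d : ℤ} (h0 : 0 ≤ α) (hc : 0 < c)
    (hd : 1 / c < d - 1) (hx : x ∈ nakadaCylinder α ε d) : x ≠ 0 ∧ |x| < c := by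
  have h := hx.2.2
  have hne : x ≠ 0 := by
    rintro rfl
    simp [nakadaDigit] at h
  refine ⟨hne, ?_⟩
  rw [nakadaDigit, if_neg hne, WithTop.coe_eq_coe, Int.floor_eq_iff] at h
  have hp : 0 < |x| := abs_pos.mpr hne
  have h2 : 1 / c < 1 / |x| := by
    have := h.1
    rw [abs_div, abs_one] at this
    linarith
  exact lt_of_one_div_lt_one_div hc h2

/-- If the orbits of `α` and of `α - 1` do not accumulate at `0`, then `T_α` has bounded non-full
range. -/
theorem hasBoundedNonFullRange_of_orbits {α c : ℝ} (hα : α ∈ Icc (0 : ℝ) 1) (hc : 0 < c)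
    (h : ∀ n : ℕ, (nakadaMap α)^[n] α = 0 ∨ c ≤ |(nakadaMap α)^[n] α|)
    (h' : ∀ n : ℕ, (nakadaMap α)^[n] (α - 1) = 0 ∨ c ≤ |(nakadaMap α)^[n] (α - 1)|) :
    NakadaHasBoundedNonFullRange α := by
  -- The full cylinder is taken on the positive side, except for `α = 0`, where only the negative
  -- side has room.
  obtain ⟨σ, ε, b, hb, hbc, hσ⟩ : ∃ (σ : ℝ) (ε : ℤ) (b : ℝ), 0 < b ∧ b ≤ c ∧
      (σ = 1 ∧ ε = 1 ∧ b ≤ α ∨ σ = -1 ∧ ε = -1 ∧ b ≤ 1 - α) := by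
    rcases hα.1.eq_or_lt with h0 | h0
    · exact ⟨-1, -1, min c 1, lt_min hc one_pos, min_le_left _ _,
        Or.inr ⟨rfl, rfl, by rw [← h0, sub_zero]; exact min_le_right _ _⟩⟩
    · exact ⟨1, 1, min c α, lt_min hc h0, min_le_left _ _, Or.inl ⟨rfl, rfl, min_le_right _ _⟩⟩
  obtain ⟨d, hd⟩ : ∃ d : ℤ, 1 / b < d - 1 := by
    obtain ⟨n, hn⟩ := exists_int_gt (1 / b + 1)
    exact ⟨n, by linarith⟩
  have hfull := isFullCylinder_of_large hα hb hd hσ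
  have havoid : ∀ x : ℝ, x = 0 ∨ c ≤ |x| → x ∉ interior (nakadaCylinder α ε d) := by
    intro x hx hi
    obtain ⟨h1, h2⟩ := abs_lt_of_mem_cylinder hα.1 hb hd (interior_subset hi)
    rcases hx with hx | hx
    · exact h1 hx
    · linarith
  refine ⟨_, ⟨?_, ε, d, rfl⟩, hfull, ?_⟩
  · apply Set.Nonempty.of_image (f := nakadaMap α)
    rw [hfull]
    exact nonempty_Ico.mpr (by linarith)
  · rintro L ⟨hL, ε', d', rfl⟩ - e he n
    rcases endpoint_of_cylinder hL he with rfl | rfl | rfl | hinv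
    · exact havoid _ (Or.inl (nakadaMap_iterate_zero α n))
    · exact havoid _ (h n)
    · exact havoid _ (h' n)
    · cases n with
      | zero => exact invCongr_not_mem_interior_cylinder hinv
      | succ n =>
        rw [Function.iterate_succ_apply, hinv.nakadaMap_eq le_rfl (by linarith)]
        exact havoid _ (h' n)

/-! ### Rational parameters -/

/-- As in the Euclidean algorithm, `p / q` is sent to a fraction over `|p|`, and `|p| ≤ q` because
the orbit stays in `[-1, 1]`. -/
theorem rational_orbit {α x : ℝ} (hα : α ∈ Icc (0 : ℝ) 1) {a b : ℤ} (hb : 0 < b)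
    (hx : x = a / b) (hxI : x ∈ Icc (α - 1) α) (n : ℕ) :
    (nakadaMap α)^[n] x ∈ Icc (α - 1) α ∧
      ∃ p q : ℤ, 0 < q ∧ q ≤ b ∧ (nakadaMap α)^[n] x = p / q := by
  induction n with
  | zero => exact ⟨hxI, a, b, hb, le_rfl, hx⟩
  | succ n ih =>
    rw [Function.iterate_succ_apply']
    obtain ⟨hI, p, q, hq, hqb, hpq⟩ := ih
    set y := (nakadaMap α)^[n] x
    refine ⟨nakadaMap_mem_Icc hα.1 hα.2, ?_⟩
    by_cases hy : y = 0
    · exact ⟨0, 1, one_pos, by omega, by simp [hy, nakadaMap_zero]⟩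
    · have hp : p ≠ 0 := by
        rintro rfl
        simp [hpq] at hy
      have hqR : (0 : ℝ) < q := by exact_mod_cast hq
      have hple : |p| ≤ q := by
        have h1 : |y| ≤ 1 := abs_le.mpr ⟨by linarith [hI.1, hα.1], by linarith [hI.2, hα.2]⟩
        rw [hpq, abs_div, abs_of_pos hqR, div_le_one hqR] at h1
        exact_mod_cast h1
      refine ⟨q - ⌊|1 / y| + 1 - α⌋ * |p|, |p|, abs_pos.mpr hp, hple.trans hqb, ?_⟩
      have hp' : |(p : ℝ)| ≠ 0 := by simpa using hp
      have hinv : |1 / y| = q / |(p : ℝ)| := by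
        rw [hpq, one_div_div, abs_div, abs_of_pos hqR]
      rw [nakadaMap, if_neg hy]
      push_cast
      rw [sub_div, mul_div_cancel_right₀ _ hp', ← hinv]

theorem rational_orbit_bound {α x : ℝ} (hα : α ∈ Icc (0 : ℝ) 1) {a b : ℤ} (hb : 0 < b)
    (hx : x = a / b) (hxI : x ∈ Icc (α - 1) α) (n : ℕ) :
    (nakadaMap α)^[n] x = 0 ∨ 1 / (b : ℝ) ≤ |(nakadaMap α)^[n] x| := by
  obtain ⟨-, p, q, hq, hqb, hpq⟩ := rational_orbit hα hb hx hxI n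
  rw [hpq]
  by_cases hp : p = 0
  · left
    simp [hp]
  · right
    have hqR : (0 : ℝ) < q := by exact_mod_cast hq
    have hp1 : (1 : ℝ) ≤ |(p : ℝ)| := by exact_mod_cast Int.one_le_abs hp
    have hqb' : (q : ℝ) ≤ b := by exact_mod_cast hqb
    rw [abs_div, abs_of_pos hqR]
    exact div_le_div₀ (by linarith) hp1 hqR hqb'

theorem hasBoundedNonFullRange_of_rational {α : ℝ} (hα : α ∈ Icc (0 : ℝ) 1)
    (hq : ∃ q : ℚ, (q : ℝ) = α) : NakadaHasBoundedNonFullRange α := by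
  obtain ⟨q, hq⟩ := hq
  have hb : 0 < (q.den : ℤ) := by exact_mod_cast q.den_pos
  have hbR : (0 : ℝ) < ((q.den : ℤ) : ℝ) := by exact_mod_cast hb
  have h1 : α = (q.num : ℝ) / ((q.den : ℤ) : ℝ) := by
    rw [← hq, Int.cast_natCast]
    exact Rat.cast_def q
  have h2 : α - 1 = ((q.num - q.den : ℤ) : ℝ) / ((q.den : ℤ) : ℝ) := by
    rw [Int.cast_sub, sub_div, div_self hbR.ne', ← h1]
  exact hasBoundedNonFullRange_of_orbits hα (c := 1 / ((q.den : ℤ) : ℝ)) (by positivity)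
    (rational_orbit_bound hα hb h1 ⟨by linarith, le_rfl⟩)
    (rational_orbit_bound hα hb h2 ⟨le_rfl, by linarith⟩)

/-! ### The slow map governing matching -/

/-- If `|1 / x|` and `|1 / y|` are congruent to `s` and `1 / s`, the pair obtained by moving one of
`x`, `y` by `T_α` has the same property with `slowMap α s` in place of `s`. -/
noncomputable def slowMap (α s : ℝ) : ℝ := if 1 + α ≤ s then s - 1 else s / (1 - s)

/-- The region of the parameters `s` in which matching takes place. -/
def matchingZone (α : ℝ) : Set ℝ := {s | s < 1 + α ∧ 1 / s < 1 + α}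

theorem le_inv_of_not_mem_zone {α s : ℝ} (h0 : 0 < α) (hs : 0 < s) (hz : s ∉ matchingZone α)
    (h : s < 1 + α) : s ≤ 1 / (1 + α) := by
  have h1 : 1 + α ≤ 1 / s := by
    by_contra hcon
    exact hz ⟨h, not_le.mp hcon⟩
  rw [le_div_iff₀ hs] at h1
  rw [le_div_iff₀ (by linarith)]
  linarith

theorem slowMap_mem_Icc {α s : ℝ} (h0 : 0 < α) (hs : s ∈ Icc α (1 / α))
    (hz : s ∉ matchingZone α) : slowMap α s ∈ Icc α (1 / α) := by
  have hs0 : 0 < s := by linarith [hs.1]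
  rw [slowMap]
  split_ifs with h
  · exact ⟨by linarith, by linarith [hs.2]⟩
  · have h1 := le_inv_of_not_mem_zone h0 hs0 hz (not_le.mp h)
    rw [le_div_iff₀ (by linarith)] at h1
    have h2 : 0 < 1 - s := by nlinarith
    constructor
    · rw [le_div_iff₀ h2]
      nlinarith [hs.1]
    · rw [div_le_div_iff₀ h2 h0]
      nlinarith

/-- Off the matching zone exactly one of `s`, `1 / s` is at least `1 + α`, so inversion swaps the
two branches. This symmetry exchanges the roles of the two orbits. -/
theorem slowMap_inv {α s : ℝ} (h0 : 0 < α) (hs : 0 < s) (hz : s ∉ matchingZone α) :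
    slowMap α (1 / s) = 1 / slowMap α s := by
  by_cases h : 1 + α ≤ s
  · have h2 : ¬ 1 + α ≤ 1 / s := by
      rw [le_div_iff₀ hs]
      nlinarith
    have h3 : s - 1 ≠ 0 := by linarith
    rw [slowMap, slowMap, if_pos h, if_neg h2, one_sub_div hs.ne']
    field_simp
  · have h2 : 1 + α ≤ 1 / s := by
      by_contra hcon
      exact hz ⟨not_le.mp h, not_le.mp hcon⟩
    rw [slowMap, slowMap, if_pos h2, if_neg h, one_div_div, sub_div, div_self hs.ne']

theorem inv_mem_matchingZone {α s : ℝ} : 1 / s ∈ matchingZone α ↔ s ∈ matchingZone α := by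
  simp only [matchingZone, mem_ofPred_eq, one_div_one_div]
  exact and_comm

theorem slowMap_iterate_mem_Icc {α s : ℝ} {n : ℕ} (h0 : 0 < α) (hs : s ∈ Icc α (1 / α))
    (hz : ∀ i < n, (slowMap α)^[i] s ∉ matchingZone α) : (slowMap α)^[n] s ∈ Icc α (1 / α) := by
  induction n with
  | zero => exact hs
  | succ n ih =>
    rw [Function.iterate_succ_apply']
    exact slowMap_mem_Icc h0 (ih fun i hi => hz i (by omega)) (hz n (by omega))

theorem slowMap_iterate_inv {α s : ℝ} {n : ℕ} (h0 : 0 < α) (hs : s ∈ Icc α (1 / α))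
    (hz : ∀ i < n, (slowMap α)^[i] s ∉ matchingZone α) :
    (slowMap α)^[n] (1 / s) = 1 / (slowMap α)^[n] s := by
  induction n with
  | zero => rfl
  | succ n ih =>
    have hz' : ∀ i < n, (slowMap α)^[i] s ∉ matchingZone α := fun i hi => hz i (by omega)
    rw [Function.iterate_succ_apply', Function.iterate_succ_apply', ih hz',
      slowMap_inv h0 (by linarith [(slowMap_iterate_mem_Icc h0 hs hz').1]) (hz n (by omega))]

theorem inv_mem_Icc {α s : ℝ} (h0 : 0 < α) (hs : s ∈ Icc α (1 / α)) :
    1 / s ∈ Icc α (1 / α) := by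
  have hs0 : 0 < s := by linarith [hs.1]
  refine ⟨?_, one_div_le_one_div_of_le h0 hs.1⟩
  have := hs.2
  rw [le_div_iff₀ h0] at this
  rw [le_div_iff₀ hs0]
  linarith

/-! ### Orbits when the slow orbit avoids the matching zone -/

theorem invCongr_slow_step {α x s : ℝ} (h0 : 0 < α) (hx : InvCongr x s) (hs : α ≤ s)
    (hz : s ≤ 1 / (1 + α)) :
    nakadaMap α x ≤ -(α / (1 + α)) ∧ InvCongr (nakadaMap α x) (s / (1 - s)) := by
  have h1 : 1 / (1 + α) < 1 := by
    rw [div_lt_one (by linarith)]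
    linarith
  rw [hx.nakadaMap_eq hs (by linarith)]
  have h2 : 0 < 1 - s := by linarith
  refine ⟨?_, by linarith, 1, ?_⟩
  · have : 1 / (1 + α) - 1 = -(α / (1 + α)) := by
      field_simp
      ring
    linarith
  · rw [abs_div, abs_of_neg (by linarith : s - 1 < 0)]
    push_cast
    rw [abs_one, neg_sub, div_add_one h2.ne']
    congr 1
    ring

theorem nakadaMap_of_slow_orbit {α x s : ℝ} (h0 : 0 < α) (hs : s ∈ Icc α (1 / α))
    (hz : ∀ i, (slowMap α)^[i] s ∉ matchingZone α) (hx : InvCongr x s) :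
    nakadaMap α x ≤ -(α / (1 + α)) ∧ ∃ t ∈ Icc α (1 / α),
      (∀ i, (slowMap α)^[i] t ∉ matchingZone α) ∧ InvCongr (nakadaMap α x) t := by
  -- Subtracting 1 from `s` leaves the congruence for `x` intact, so `x` waits through finitely many
  -- such steps until the other branch applies `T_α` to it.
  obtain ⟨N, hN⟩ := exists_nat_gt s
  induction N generalizing s with
  | zero => linarith [hs.1, show s < 0 by simpa using hN]
  | succ N ih =>
    have hmem : slowMap α s ∈ Icc α (1 / α) := slowMap_mem_Icc h0 hs (hz 0)
    have hz' : ∀ i, (slowMap α)^[i] (slowMap α s) ∉ matchingZone α := fun i => hz (i + 1)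
    by_cases h : 1 + α ≤ s
    · have he : slowMap α s = s - 1 := if_pos h
      rw [he] at hmem hz'
      push_cast at hN
      exact ih hmem hz' hx.sub_one (by linarith)
    · have he : slowMap α s = s / (1 - s) := if_neg h
      rw [he] at hmem hz'
      obtain ⟨h1, h2⟩ := invCongr_slow_step h0 hx hs.1
        (le_inv_of_not_mem_zone h0 (by linarith [hs.1]) (hz 0) (not_le.mp h))
      exact ⟨h1, _, hmem, hz', h2⟩

theorem orbit_of_slow_orbit {α x s : ℝ} (h0 : 0 < α) (hs : s ∈ Icc α (1 / α))
    (hz : ∀ i, (slowMap α)^[i] s ∉ matchingZone α) (hx : InvCongr x s)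
    (hxa : α / (1 + α) ≤ |x|) (n : ℕ) : α / (1 + α) ≤ |(nakadaMap α)^[n] x| := by
  induction n generalizing x s with
  | zero => exact hxa
  | succ n ih =>
    obtain ⟨h1, t, ht, htz, htx⟩ := nakadaMap_of_slow_orbit h0 hs hz hx
    exact ih ht htz htx (le_trans (by linarith) (neg_le_abs _))

theorem invCongr_start {α : ℝ} (h0 : 0 < α) (h1 : α < 1) :
    InvCongr α (1 / α - 1) ∧ InvCongr (α - 1) (1 / (1 / α - 1)) := by
  have h2 : 1 - α ≠ 0 := by linarith
  refine ⟨⟨h0.ne', 1, ?_⟩, by linarith, 1, ?_⟩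
  · rw [abs_of_pos (by positivity)]
    push_cast
    ring
  · rw [abs_div, abs_of_neg (by linarith : α - 1 < 0), neg_sub, abs_one, div_sub_one h0.ne',
      one_div_div]
    push_cast
    field_simp
    ring

theorem start_mem_Icc {α : ℝ} (h0 : 0 < α) (hg : α * (1 + α) ≤ 1) :
    1 / α - 1 ∈ Icc α (1 / α) := by
  refine ⟨?_, by linarith⟩
  have : 1 + α ≤ 1 / α := by
    rw [le_div_iff₀ h0]
    linarith
  linarith

theorem hasBoundedNonFullRange_of_slow_orbit {α : ℝ} (h0 : 0 < α) (hg : α * (1 + α) ≤ 1)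
    (hz : ∀ i, (slowMap α)^[i] (1 / α - 1) ∉ matchingZone α) :
    NakadaHasBoundedNonFullRange α := by
  have h1 : α < 1 := by nlinarith
  have hs := start_mem_Icc h0 hg
  obtain ⟨hx, hy⟩ := invCongr_start h0 h1
  have hc : α / (1 + α) ≤ α := div_le_self h0.le (by linarith)
  have hc' : α / (1 + α) ≤ 1 - α := by
    rw [div_le_iff₀ (by linarith)]
    linarith
  refine hasBoundedNonFullRange_of_orbits ⟨h0.le, h1.le⟩ (c := α / (1 + α)) (by positivity)
    (fun n => Or.inr (orbit_of_slow_orbit h0 hs hz hx (by rwa [abs_of_pos h0]) n))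
    (fun n => Or.inr (orbit_of_slow_orbit h0 (inv_mem_Icc h0 hs) (fun i => ?_) hy ?_ n))
  · rw [slowMap_iterate_inv h0 hs fun i _ => hz i, inv_mem_matchingZone]
    exact hz i
  · rw [abs_of_neg (by linarith)]
    linarith

/-! ### Matching when the slow orbit enters the matching zone -/

theorem exists_matchingInterval {α : ℝ} {k k' : ℕ} (hα : α ∈ Icc (0 : ℝ) 1) (hk : 0 < k)
    (hk' : 0 < k')
    (h : ∀ᶠ β in 𝓝 α, β ∈ Icc (0 : ℝ) 1 →
      (nakadaMap β)^[k] β = (nakadaMap β)^[k'] (β - 1)) :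
    α ∉ nakadaExceptionalSet := by
  obtain ⟨r, hr, hball⟩ := Metric.eventually_nhds_iff_ball.mp h
  refine fun hE => hE.2 ⟨Metric.ball α r ∩ Icc 0 1, ⟨?_, ⟨_, Metric.isOpen_ball, rfl⟩,
    k, k', hk, hk', fun β hβ => hball β hβ.1 hβ.2⟩, Metric.mem_ball_self hr, hα⟩
  rw [Real.ball_eq_Ioo]
  exact ordConnected_Ioo.inter ordConnected_Icc

/-- The orbits of `β` and `β - 1`, for `β` near `α`, reach points `x`, `y` with `|1 / x|` and
`|1 / y|` congruent to `f β` and `1 / f β`, where `f` is continuous at `α` with value `s`. -/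
def LocalSlowState (α s : ℝ) : Prop :=
  ∃ (f : ℝ → ℝ) (k k' : ℕ), ContinuousAt f α ∧ f α = s ∧ ∀ᶠ β in 𝓝 α,
    InvCongr ((nakadaMap β)^[k] β) (f β) ∧ InvCongr ((nakadaMap β)^[k'] (β - 1)) (1 / f β)

theorem LocalSlowState.start {α : ℝ} (h0 : 0 < α) (h1 : α < 1) :
    LocalSlowState α (1 / α - 1) := by
  refine ⟨fun β => 1 / β - 1, 0, 0, ?_, rfl, ?_⟩
  · exact (continuousAt_const.div continuousAt_id h0.ne').sub continuousAt_const
  · filter_upwards [Ioo_mem_nhds h0 h1] with β hβ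
    exact invCongr_start hβ.1 hβ.2

/-- The branch chosen at `α` is kept for all nearby `β`. Evaluating `T_β` then only needs `β < f β <
1` or `β < 1 / f β < 1`; the strict bounds on `s` make these open conditions. -/
theorem LocalSlowState.step {α s : ℝ} (h0 : 0 < α) (hs : s ∈ Ioo α (1 / α))
    (hz : s ∉ matchingZone α) (h : LocalSlowState α s) : LocalSlowState α (slowMap α s) := by
  obtain ⟨f, k, k', hf, rfl, hev⟩ := h
  have hs0 : 0 < f α := by linarith [hs.1]
  by_cases hc : 1 + α ≤ f α
  · have hinv : ContinuousAt (fun β => 1 / f β) α := continuousAt_const.div hf hs0.ne'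
    have hlt : α < 1 / f α := by
      have := hs.2
      rw [lt_div_iff₀ h0] at this
      rw [lt_div_iff₀ hs0]
      linarith
    refine ⟨fun β => f β - 1, k, k' + 1, hf.sub continuousAt_const, (if_pos hc).symm, ?_⟩
    filter_upwards [hev, hf.eventually_const_lt (show 1 < f α by linarith),
      continuousAt_id.eventually_lt hinv hlt, Ioi_mem_nhds h0] with β hβ h1 h2 h3
    have h2 : β < 1 / f β := h2
    have h3 : 0 < β := h3
    have h4 : 1 / f β < 1 := by
      rw [div_lt_one (by linarith)]
      exact h1
    refine ⟨hβ.1.sub_one, ?_⟩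
    rw [Function.iterate_succ_apply', hβ.2.nakadaMap_eq h2.le (by linarith)]
    refine ⟨by linarith, 1, ?_⟩
    have h5 : f β ≠ 0 := by linarith
    have h6 : f β - 1 ≠ 0 := by linarith
    rw [abs_div, abs_of_neg (by linarith : 1 / f β - 1 < 0), neg_sub, one_sub_div h5, abs_one,
      one_div_div]
    push_cast
    field_simp
    ring
  · have hle := le_inv_of_not_mem_zone h0 hs0 hz (not_le.mp hc)
    have hlt1 : f α < 1 := by
      have : 1 / (1 + α) < 1 := by
        rw [div_lt_one (by linarith)]
        linarith
      linarith
    refine ⟨fun β => f β / (1 - f β), k + 1, k',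
      hf.div (continuousAt_const.sub hf) (by linarith), (if_neg hc).symm, ?_⟩
    filter_upwards [hev, hf.eventually_lt_const hlt1, continuousAt_id.eventually_lt hf hs.1,
      Ioi_mem_nhds h0] with β hβ h1 h2 h3
    have h2 : β < f β := h2
    have h3 : 0 < β := h3
    refine ⟨?_, ?_⟩
    · rw [Function.iterate_succ_apply', hβ.1.nakadaMap_eq h2.le (by linarith)]
      refine ⟨by linarith, 1, ?_⟩
      have h6 : 1 - f β ≠ 0 := by linarith
      rw [abs_div, abs_of_neg (by linarith : f β - 1 < 0), neg_sub, abs_one]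
      push_cast
      field_simp
      ring
    · have h5 : f β ≠ 0 := by linarith
      rw [one_div_div, sub_div, div_self h5]
      exact hβ.2.sub_one

/-- For `s ≠ 1` the reciprocals of `s - 1` and `1 / s - 1` have opposite signs and sum to `-1`, so
their absolute values differ by 1. -/
theorem nakadaMap_eq_of_inv {β s : ℝ} (hs : 0 < s) :
    nakadaMap β (s - 1) = nakadaMap β (1 / s - 1) := by
  rcases lt_trichotomy s 1 with h | rfl | h
  · have h1 : 1 < 1 / s := by
      rw [lt_div_iff₀ hs]
      linarith
    have h2 : 1 - s ≠ 0 := by linarith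
    refine InvCongr.map_eq_map (s := 1 / (1 - s)) ⟨by linarith, 0, ?_⟩ ⟨by linarith, -1, ?_⟩
    · rw [abs_div, abs_of_neg (by linarith : s - 1 < 0), neg_sub, abs_one]
      simp
    · rw [abs_of_pos (by apply div_pos one_pos; linarith), div_sub_one hs.ne', one_div_div]
      push_cast
      field_simp
      ring
  · simp
  · have h1 : 1 / s < 1 := by
      rw [div_lt_iff₀ hs]
      linarith
    have h2 : s - 1 ≠ 0 := by linarith
    refine InvCongr.map_eq_map (s := 1 / (s - 1)) ⟨by linarith, 0, ?_⟩ ⟨by linarith, 1, ?_⟩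
    · rw [abs_of_pos (by apply div_pos one_pos; linarith)]
      simp
    · rw [abs_div, abs_of_neg (by linarith : 1 / s - 1 < 0), neg_sub, abs_one,
        one_sub_div hs.ne', one_div_div]
      push_cast
      field_simp
      ring

theorem LocalSlowState.matching {α s : ℝ} (h0 : 0 < α) (hg : α * (1 + α) ≤ 1) (hs : 0 < s)
    (hz : s ∈ matchingZone α) (h : LocalSlowState α s) : α ∉ nakadaExceptionalSet := by
  have hα1 : α ≤ 1 := by nlinarith
  obtain ⟨f, k, k', hf, rfl, hev⟩ := h
  have hinv : ContinuousAt (fun β => 1 / f β) α := continuousAt_const.div hf hs.ne'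
  have hadd : ContinuousAt (fun β : ℝ => 1 + β) α := continuousAt_const.add continuousAt_id
  -- The golden mean bound enters here: `1 / s < 1 + α` gives `s > 1 / (1 + α) ≥ α`, and likewise
  -- for `1 / s`.
  have h1 : α < f α := by
    have := hz.2
    rw [div_lt_iff₀ hs] at this
    nlinarith
  have h2 : α < 1 / f α := by
    have := hz.1
    rw [lt_div_iff₀ hs]
    nlinarith
  refine exists_matchingInterval ⟨h0.le, hα1⟩ (Nat.succ_pos (k + 1)) (Nat.succ_pos (k' + 1)) ?_
  filter_upwards [hev, continuousAt_id.eventually_lt hf h1, continuousAt_id.eventually_lt hinv h2,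
    hf.eventually_lt hadd hz.1, hinv.eventually_lt hadd hz.2, hf.eventually_const_lt hs]
    with β hβ h3 h4 h5 h6 h7 _
  have h3 : β < f β := h3
  have h4 : β < 1 / f β := h4
  rw [Function.iterate_succ_apply', Function.iterate_succ_apply',
    Function.iterate_succ_apply', Function.iterate_succ_apply',
    hβ.1.nakadaMap_eq h3.le h5, hβ.2.nakadaMap_eq h4.le h6]
  exact nakadaMap_eq_of_inv h7

theorem slow_orbit_avoids_zone {α : ℝ} (h0 : 0 < α) (hg : α * (1 + α) ≤ 1)
    (hE : α ∈ nakadaExceptionalSet) (n : ℕ) :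
    (slowMap α)^[n] (1 / α - 1) ∉ matchingZone α := by
  classical
  by_contra hn
  have hex : ∃ n, (slowMap α)^[n] (1 / α - 1) ∈ matchingZone α := ⟨n, hn⟩
  obtain ⟨N, hN, hmin⟩ : ∃ N, (slowMap α)^[N] (1 / α - 1) ∈ matchingZone α ∧
      ∀ i < N, (slowMap α)^[i] (1 / α - 1) ∉ matchingZone α :=
    ⟨Nat.find hex, Nat.find_spec hex, fun i hi => Nat.find_min hex hi⟩
  have h1 : α < 1 := by nlinarith
  have hs := start_mem_Icc h0 hg
  have hmem : ∀ i ≤ N, (slowMap α)^[i] (1 / α - 1) ∈ Icc α (1 / α) := fun i hi =>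
    slowMap_iterate_mem_Icc h0 hs fun j hj => hmin j (by omega)
  have hsplit : ∀ i < N, (slowMap α)^[N] (1 / α - 1) =
      (slowMap α)^[N - 1 - i] (slowMap α ((slowMap α)^[i] (1 / α - 1))) := by
    intro i hi
    rw [← Function.iterate_succ_apply' (slowMap α), ← Function.iterate_add_apply]
    congr 2
    omega
  -- Hitting `α` or `1 / α` would break local constancy. But `slowMap` sends these to the inverse of
  -- the starting value and to the starting value itself, so the zone would already be entered at
  -- time `N - 1 - i`, against minimality of `N`.
  have hne : ∀ i < N, (slowMap α)^[i] (1 / α - 1) ∈ Ioo α (1 / α) := by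
    intro i hi
    have hsp := hsplit i hi
    refine ⟨lt_of_le_of_ne (hmem i hi.le).1 fun he => ?_,
      lt_of_le_of_ne (hmem i hi.le).2 fun he => ?_⟩
    · have hα : slowMap α α = 1 / (1 / α - 1) := by
        rw [slowMap, if_neg (by linarith), div_sub_one h0.ne', one_div_div]
      rw [← he, hα, slowMap_iterate_inv h0 hs fun j hj => hmin j (by omega)] at hsp
      rw [hsp, inv_mem_matchingZone] at hN
      exact hmin _ (by omega) hN
    · have hα : slowMap α (1 / α) = 1 / α - 1 := if_pos (by linarith [hs.1])
      rw [he, hα] at hsp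
      rw [hsp] at hN
      exact hmin _ (by omega) hN
  have hst : ∀ i ≤ N, LocalSlowState α ((slowMap α)^[i] (1 / α - 1)) := by
    intro i
    induction i with
    | zero => exact fun _ => LocalSlowState.start h0 h1
    | succ i ih =>
      intro hi
      rw [Function.iterate_succ_apply']
      exact (ih (by omega)).step h0 (hne i hi) (hmin i hi)
  exact (hst N le_rfl).matching h0 hg (lt_of_lt_of_le h0 (hmem N le_rfl).1) hN hE

/-- Matching for parameters above the golden mean. -/
theorem not_mem_exceptionalSet_of_large {α : ℝ} (h0 : 0 < α) (h1 : α ≤ 1)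
    (hg : 1 < α * (1 + α)) : α ∉ nakadaExceptionalSet := by
  -- Here `1 ≤ 1 / β < 1 + β`, so `T_β(β) = 1 / β - 1`, which has the same image as `β - 1`.
  refine exists_matchingInterval ⟨h0.le, h1⟩ two_pos one_pos ?_
  have hc : ContinuousAt (fun β : ℝ => β * (1 + β)) α := by fun_prop
  filter_upwards [hc.eventually_const_lt hg, Ioi_mem_nhds h0] with β h2 h3 hβ
  have h3 : 0 < β := h3
  have h4 : InvCongr β (1 / β) := ⟨h3.ne', 0, by rw [abs_of_pos (by positivity)]; simp⟩
  have h5 : 1 ≤ 1 / β := by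
    rw [le_div_iff₀ h3]
    linarith [hβ.2]
  have h6 : 1 / β < 1 + β := by
    rw [div_lt_iff₀ h3]
    linarith
  change nakadaMap β (nakadaMap β β) = nakadaMap β (β - 1)
  rw [h4.nakadaMap_eq (by linarith [hβ.2]) h6]
  exact (nakadaMap_eq_of_inv h3).symm

theorem hasBoundedNonFullRange_of_mem_exceptionalSet {α : ℝ} (hE : α ∈ nakadaExceptionalSet) :
    NakadaHasBoundedNonFullRange α := by
  rcases hE.1.1.eq_or_lt with h0 | h0
  · exact hasBoundedNonFullRange_of_rational hE.1 ⟨0, by simpa using h0⟩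
  · by_cases hg : α * (1 + α) ≤ 1
    · exact hasBoundedNonFullRange_of_slow_orbit h0 hg (slow_orbit_avoids_zone h0 hg hE)
    · exact absurd hE (not_mem_exceptionalSet_of_large h0 hE.1.2 (not_le.mp hg))

theorem lemmap :
    (∀ α : ℝ, α ∈ Ioc (0 : ℝ) 1 → (∃ q : ℚ, (q : ℝ) = α) → NakadaHasBoundedNonFullRange α) ∧
      (∀ α : ℝ, α ∈ nakadaExceptionalSet → NakadaHasBoundedNonFullRange α) :=
  ⟨fun _ hα hq => hasBoundedNonFullRange_of_rational (Ioc_subset_Icc_self hα) hq,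
    fun _ hE => hasBoundedNonFullRange_of_mem_exceptionalSet hE⟩
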